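/- Machine activation problem: there are $m$ machines, machine $i$ having startup cost $c_i\ge 0$, and $n$ jobs, job $j$ having processing time $p_{ij}>0$ on machine $i$. A schedule assigns each job to a machine; its cost is the sum of the startup costs of the machines that receive at least one job, the load of a machine is the sum of the processing times (on that machine) of the jobs assigned to it, and the makespan is the maximum load. In the online problem, the machines, their startup costs, the makespan limit $L$, the cost budget $B$ and the number $n$ of jobs are known in advance. The jobs arrive one at a time; the processing times $(p_{ij})_i$ of job $j$ are revealed when it arrives, and the job must then be assigned irrevocably to a machine. Theorem. There is a randomized online algorithm for the machine activation problem with bicriteria competitive ratio $(O(\log(mn)\log m),\,O(\log m))$. That is, there is an absolute constant $C>0$ such that for all $m\ge 2$, all $n$, all startup costs $c_1,\dots,c_m\ge 0$ and all reals $L,B$ there is a randomized online algorithm, depending only on these data, with the following property. For every (fixed) sequence of $n$ jobs with positive processing times for which some offline schedule has makespan at most $L$ and cost at most $B$ (in particular when an optimal offline schedule subject to makespan at most $L$ has cost $B$), the algorithm's schedule has expected startup cost at most $C\,B\log(mn)\log m$ and, with probability at least $1-2/m$, makespan at most $C\,L\log m$. (For $n=0$, both quantities are zero and the bound on the cost is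 read as $0$.) -/

import Mathlib

open MeasureTheory
open scoped BigOperators

namespace MachineActivation

/-- A schedule assigns each of `n` jobs to one of `m` machines. -/
abbrev Schedule (m n : ℕ) : Type := Fin n → Fin m

/-- The machines to which at least one job has been assigned. -/
def activeMachines {m n : ℕ} (S : Schedule m n) : Finset (Fin m) :=
  Finset.univ.filter (fun i => ∃ j, S j = i)

/-- The total startup cost of the active machines; `c i` is the startup cost of machine `i`. -/
def startupCost {m n : ℕ} (c : Fin m → ℝ) (S : Schedule m n) : ℝ :=
  ∑ i ∈ activeMachines S, c i

/-- The load of machine `i`: the sum of the processing times of the jobs assigned to it, where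
`p i j` is the processing time of job `j` on machine `i`. -/
def load {m n : ℕ} (p : Fin m → Fin n → ℝ) (S : Schedule m n) (i : Fin m) : ℝ :=
  ∑ j ∈ Finset.univ.filter (fun j => S j = i), p i j

/-- The makespan: the maximum load of a machine. -/
noncomputable def makespan {m n : ℕ} (p : Fin m → Fin n → ℝ) (S : Schedule m n) : ℝ :=
  ⨆ i, load p S i

/-- A randomized online algorithm for `m` machines and `n` jobs arriving in the order
`0, 1, …, n - 1`. Its random bits `ω` are drawn from a probability space that is fixed before the
jobs arrive. Given `ω` it assigns every job, irrevocably on arrival, to a machine: the machine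
chosen for job `j` depends only on the processing times of the jobs that have arrived so far
(including `j`). -/
structure RandomizedOnlineAlgorithm (m n : ℕ) where
  Ω : Type
  [measurableSpace : MeasurableSpace Ω]
  μ : Measure Ω
  [isProbabilityMeasure : IsProbabilityMeasure μ]
  assign : Ω → (Fin m → Fin n → ℝ) → Schedule m n
  nonanticipating : ∀ (ω : Ω) (p p' : Fin m → Fin n → ℝ) (j : Fin n),
    (∀ k, k ≤ j → ∀ i, p i k = p' i k) → assign ω p j = assign ω p' j
  measurable_assign : ∀ (p : Fin m → Fin n → ℝ) (j : Fin n), Measurable fun ω => assign ω p j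

attribute [instance] RandomizedOnlineAlgorithm.measurableSpace
attribute [instance] RandomizedOnlineAlgorithm.isProbabilityMeasure

namespace RandomizedOnlineAlgorithm

/-- The expected startup cost of the schedule that the algorithm produces on the instance `p`. -/
noncomputable def expectedCost {m n : ℕ} (A : RandomizedOnlineAlgorithm m n)
    (c : Fin m → ℝ) (p : Fin m → Fin n → ℝ) : ℝ :=
  ∫ ω, startupCost c (A.assign ω p) ∂A.μ

/-- The probability that the schedule produced on the instance `p` has makespan at most `T`. -/
noncomputable def probMakespanLE {m n : ℕ} (A : RandomizedOnlineAlgorithm m n)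
    (p : Fin m → Fin n → ℝ) (T : ℝ) : ℝ :=
  A.μ.real {ω | makespan p (A.assign ω p) ≤ T}

end RandomizedOnlineAlgorithm

end MachineActivation

namespace MachineActivation

/-! A deterministic online fractional algorithm maintains activation levels `X i`, starting at `1 /
m`, and rounding uses independent exponential thresholds. Put `w i = c i / B + 1 / m` and `q i = p i
j / L`. On each arrival, water-filling to a height `θ` raises the cheap machines until eligible
levels sum to at least 1. A small candidate set `A` of total level at least 1 is then chosen, and
each candidate's level is multiplied by `exp (q i / 10)`.

Since being a candidate costs a multiplicative increase, the total candidate load of a machine is at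
most 10 times the growth of its log-level (`sum_load_le_log`). A step increases `∑ w i * X i` by at
most `θ / 2`. Each eligible machine, in particular the offline choice, pays for this by its own
price or by growth of its log-level (`exists_isStep`). Summed along the offline schedule, the prices
use at most half of the final potential plus a constant and the logs telescope, so the potential is
`O(log m)` (`potential_le`). Hence levels are polynomial in `m` and loads are `O(L log m)`.

A machine opens when `K` times its level reaches its threshold. Independence gives probability at
most `exp (-K)` that a job sees no open candidate. With `K = 2 log (mn)`, a union bound controls
failure, and the expected cost is `K * B` times the potential, up to a term of size `B`. -/

/-! ### Water-filling and one fractional step. -/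

/-- The sum jumps when `θ` passes some `h i`, so equality with 1 may be unattainable. Taking the
least admissible `θ` gives one inequality with the jump included and the reverse one with it
excluded. -/
lemma exists_threshold {ι : Type*} (E : Finset ι) (hE : E.Nonempty) (h r X : ι → ℝ)
    (hh : ∀ i ∈ E, 0 ≤ h i) (hr : ∀ i ∈ E, 0 < r i) (hX : ∀ i ∈ E, 0 < X i) :
    ∃ θ : ℝ, 0 ≤ θ ∧
      1 ≤ ∑ i ∈ E with h i ≤ θ, X i * Real.exp (r i * (θ - h i)) ∧
      ∑ i ∈ E with h i < θ, X i * Real.exp (r i * (θ - h i)) ≤ 1 := by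
  classical
  let f : Finset ι → ℝ → ℝ := fun T θ => ∑ i ∈ T, X i * Real.exp (r i * (θ - h i))
  have hf : ∀ T, Continuous (f T) := fun T => by fun_prop
  let S : Set ℝ := ⋃ T ∈ E.powerset, {θ | 0 ≤ θ ∧ (∀ i ∈ T, h i ≤ θ) ∧ 1 ≤ f T θ}
  have hmem : ∀ θ, θ ∈ S ↔ ∃ T ⊆ E, 0 ≤ θ ∧ (∀ i ∈ T, h i ≤ θ) ∧ 1 ≤ f T θ := by
    intro θ
    simp only [S, Set.mem_iUnion, Finset.mem_powerset, Set.mem_ofPred_eq, exists_prop]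
  have hclosed : IsClosed S := by
    refine Set.Finite.isClosed_biUnion (Finset.finite_toSet _) fun T _ => ?_
    refine isClosed_Ici.inter (IsClosed.inter ?_ (isClosed_le continuous_const (hf T)))
    have : {θ : ℝ | ∀ i ∈ T, h i ≤ θ} = ⋂ i ∈ T, Set.Ici (h i) := by ext; simp
    change IsClosed {θ : ℝ | ∀ i ∈ T, h i ≤ θ}
    rw [this]
    exact isClosed_biInter fun i _ => isClosed_Ici
  have hne : S.Nonempty := by
    obtain ⟨i, hi⟩ := hE
    have h1 := hh i hi
    have h2 := hr i hi
    have h3 := hX i hi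
    -- This height makes the exponent `1 / X i`, and `x * exp (1 / x) ≥ x + 1`.
    refine ⟨h i + 1 / (r i * X i), (hmem _).2 ⟨{i}, by simpa using hi, by positivity, ?_, ?_⟩⟩
    · intro k hk
      rw [Finset.mem_singleton.1 hk]
      have : 0 < 1 / (r i * X i) := by positivity
      linarith
    · have e : r i * (h i + 1 / (r i * X i) - h i) = 1 / X i := by field_simp; ring
      simp only [f, Finset.sum_singleton, e]
      have := Real.add_one_le_exp (1 / X i)
      calc (1 : ℝ) ≤ X i * (1 / X i + 1) := by
            rw [mul_add, mul_one_div_cancel h3.ne']; linarith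
        _ ≤ _ := by gcongr
  have hbdd : BddBelow S := ⟨0, fun θ hθ => by
    obtain ⟨T, -, h0, -⟩ := (hmem θ).1 hθ; exact h0⟩
  obtain ⟨T, hTE, h0, hT, h1⟩ := (hmem _).1 (hclosed.csInf_mem hne hbdd)
  refine ⟨sInf S, h0, h1.trans ?_, ?_⟩
  · refine Finset.sum_le_sum_of_subset_of_nonneg
      (fun i hi => Finset.mem_filter.2 ⟨hTE hi, hT i hi⟩) fun i hi _ => ?_
    have := hX i (Finset.mem_filter.1 hi).1
    positivity
  · set θ := sInf S with hθ
    -- If the strict sum exceeded 1, continuity would make a slightly smaller height admissible.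
    by_contra! hlt
    let T' := E.filter fun i => h i < θ
    have hev : ∀ᶠ t in nhds θ, 1 < f T' t ∧ ∀ i ∈ T', h i < t :=
      ((hf T').continuousAt.eventually (lt_mem_nhds hlt)).and
        ((Filter.eventually_all_finset T').2 fun i hi =>
          lt_mem_nhds (Finset.mem_filter.1 hi).2)
    obtain ⟨t, ht, htθ⟩ := ((hev.filter_mono nhdsWithin_le_nhds).and
      (self_mem_nhdsWithin : Set.Iio θ ∈ nhdsWithin θ (Set.Iio θ))).exists
    obtain ⟨i, hi⟩ : T'.Nonempty := by
      by_contra hn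
      rw [Finset.not_nonempty_iff_eq_empty] at hn
      have := ht.1
      simp [f, hn] at this
      linarith
    have hti := ht.2 i hi
    have h0t : 0 ≤ t := (hh i (Finset.mem_filter.1 hi).1).trans hti.le
    have : t ∈ S := (hmem t).2 ⟨T', Finset.filter_subset _ _, h0t, fun k hk => (ht.2 k hk).le, ht.1.le⟩
    exact absurd (csInf_le hbdd this) (not_le.2 htθ)

/-- Take `A` of minimal cardinality: all elements but one sum to less than 1, and the truncation
caps the remaining one at 1. -/
lemma exists_subset_one_le_sum {ι : Type*} (T : Finset ι) (Y : ι → ℝ)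
    (h1 : 1 ≤ ∑ i ∈ T, Y i) :
    ∃ A ⊆ T, 1 ≤ ∑ i ∈ A, Y i ∧ ∑ i ∈ A, min 1 (Y i) ≤ 2 := by
  classical
  obtain ⟨A, hA, hmin⟩ := Finset.exists_min_image
    (T.powerset.filter fun A => 1 ≤ ∑ i ∈ A, Y i) Finset.card ⟨T, by simpa using h1⟩
  simp only [Finset.mem_filter, Finset.mem_powerset] at hA hmin
  refine ⟨A, hA.1, hA.2, ?_⟩
  obtain ⟨a, ha⟩ : A.Nonempty := by
    by_contra hn
    rw [Finset.not_nonempty_iff_eq_empty] at hn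
    have := hA.2
    simp [hn] at this
    linarith
  have hlt : ∑ i ∈ A.erase a, Y i < 1 := by
    by_contra! hle
    have := hmin (A.erase a) ⟨(Finset.erase_subset _ _).trans hA.1, hle⟩
    have := Finset.card_erase_lt_of_mem ha
    omega
  rw [← Finset.add_sum_erase _ _ ha]
  have h2 : ∑ i ∈ A.erase a, min 1 (Y i) ≤ ∑ i ∈ A.erase a, Y i :=
    Finset.sum_le_sum fun i _ => min_le_right _ _
  have := min_le_left 1 (Y a)
  linarith

/-- One step of the fractional algorithm: from the activation levels `X`, a job with normalised
processing times `q` and eligible machines `E` leads to the levels `Z`, and the job may be assigned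
to the machines in `A`. -/
structure IsStep {ι : Type*} [Fintype ι] (w q X : ι → ℝ) (E : Finset ι) (Z : ι → ℝ)
    (A : Finset ι) : Prop where
  subset : A ⊆ E
  le : ∀ i, X i ≤ Z i
  mul_exp_le : ∀ i ∈ A, X i * Real.exp (q i / 10) ≤ Z i
  one_le_sum : 1 ≤ ∑ i ∈ A, Z i
  -- The bound holds for every eligible machine, so the offline choice, unknown to the algorithm,
  -- can be inserted. The logarithm is capped at 0 so that its telescoped total is bounded above.
  sum_le : ∀ i ∈ E, ∑ k, w k * (Z k - X k) ≤
    1 / 2 * (w i * max 1 (X i) * q i) + 5 * (w i * (min 0 (Real.log (Z i)) - min 0 (Real.log (X i))))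

lemma exists_isStep {ι : Type*} [Fintype ι] (w q X : ι → ℝ) (E : Finset ι) (hE : E.Nonempty)
    (hw : ∀ i, 0 < w i) (hq : ∀ i ∈ E, 0 < q i) (hq1 : ∀ i ∈ E, q i ≤ 1)
    (hX : ∀ i ∈ E, 0 < X i) : ∃ Z A, IsStep w q X E Z A := by
  classical
  let h : ι → ℝ := fun i => w i * max 1 (X i) * q i
  have hh : ∀ i ∈ E, 0 < h i := fun i hi => by
    have := hw i; have := hq i hi; positivity
  obtain ⟨θ, hθ, hge, hle⟩ := exists_threshold E hE h (fun i => 1 / (10 * w i)) X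
    (fun i hi => (hh i hi).le) (fun i _ => by have := hw i; positivity) hX
  let s : ι → ℝ := fun i => 1 / (10 * w i) * (θ - h i)
  let Y : ι → ℝ := fun i => if i ∈ E ∧ h i < θ then X i * Real.exp (s i) else X i
  have hYr : ∀ i ∈ E, h i < θ → Y i = X i * Real.exp (s i) := fun i hi hlt => if_pos ⟨hi, hlt⟩
  have hYn : ∀ i, ¬ (i ∈ E ∧ h i < θ) → Y i = X i := fun i hi => if_neg hi
  have hs : ∀ i, h i < θ → 0 ≤ s i := fun i hi => by
    have := hw i; have : 0 < θ - h i := by linarith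
    positivity
  have hXY : ∀ i, X i ≤ Y i := fun i => by
    by_cases hi : i ∈ E ∧ h i < θ
    · rw [hYr i hi.1 hi.2]
      exact le_mul_of_one_le_right (hX i hi.1).le (Real.one_le_exp (hs i hi.2))
    · exact (hYn i hi).ge
  have hYpos : ∀ i ∈ E, 0 < Y i := fun i hi => (hX i hi).trans_le (hXY i)
  have hsumY : ∑ i ∈ E with h i < θ, Y i ≤ 1 := by
    refine le_trans (Finset.sum_le_sum fun i hi => ?_) hle
    rw [Finset.mem_filter] at hi
    exact (hYr i hi.1 hi.2).le
  have hY1 : ∀ i ∈ E, h i < θ → Y i ≤ 1 := fun i hi hlt =>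
    (Finset.single_le_sum (f := Y) (fun k hk => (hYpos k (Finset.mem_filter.1 hk).1).le)
      (Finset.mem_filter.2 ⟨hi, hlt⟩)).trans hsumY
  have hgeY : 1 ≤ ∑ i ∈ E with h i ≤ θ, Y i := by
    refine hge.trans (Finset.sum_le_sum fun i hi => ?_)
    rw [Finset.mem_filter] at hi
    rcases hi.2.lt_or_eq with hlt | heq
    · exact (hYr i hi.1 hlt).ge
    · rw [hYn i (fun hc => hc.2.ne heq), heq]; simp
  obtain ⟨A, hAT, hA1, hA2⟩ := exists_subset_one_le_sum _ Y hgeY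
  have hAE : A ⊆ E := hAT.trans (Finset.filter_subset _ _)
  have hAθ : ∀ i ∈ A, h i ≤ θ := fun i hi => (Finset.mem_filter.1 (hAT hi)).2
  let Z : ι → ℝ := fun i => if i ∈ A then Y i * Real.exp (q i / 10) else Y i
  have hYZ : ∀ i, Y i ≤ Z i := fun i => by
    by_cases hi : i ∈ A
    · simp only [Z, if_pos hi]
      exact le_mul_of_one_le_right (hYpos i (hAE hi)).le
        (Real.one_le_exp (by have := hq i (hAE hi); positivity))
    · simp [Z, hi]
  -- A raised machine has `w k * s k ≤ θ / 10`, and the raised levels sum to at most 1.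
  have hraise : ∑ k, w k * (Y k - X k) ≤ θ / 10 := by
    have e : ∑ k, w k * (Y k - X k) = ∑ k ∈ E with h k < θ, w k * (Y k - X k) := by
      symm
      apply Finset.sum_subset (Finset.subset_univ _)
      intro k _ hk
      rw [Finset.mem_filter] at hk
      rw [hYn k hk]; ring
    rw [e]
    calc _ ≤ ∑ k ∈ E with h k < θ, θ / 10 * Y k := by
          refine Finset.sum_le_sum fun k hk => ?_
          rw [Finset.mem_filter] at hk
          have h1 : Real.exp (s k) - 1 ≤ s k * Real.exp (s k) := by
            have := Real.one_sub_le_exp_neg (s k)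
            rw [Real.exp_neg] at this
            have hp := Real.exp_pos (s k)
            have := mul_le_mul_of_nonneg_right this hp.le
            rw [inv_mul_cancel₀ hp.ne'] at this
            linarith
          have hwk := hw k
          have h2 : w k * s k ≤ θ / 10 := by
            have : w k * s k = (θ - h k) / 10 := by simp only [s]; field_simp
            have := hh k hk.1
            linarith
          rw [hYr k hk.1 hk.2]
          have hXk := hX k hk.1
          calc w k * (X k * Real.exp (s k) - X k) = w k * X k * (Real.exp (s k) - 1) := by ring
            _ ≤ w k * X k * (s k * Real.exp (s k)) := by gcongr
            _ = w k * s k * (X k * Real.exp (s k)) := by ring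
            _ ≤ _ := by gcongr
      _ = θ / 10 * ∑ k ∈ E with h k < θ, Y k := by rw [Finset.mul_sum]
      _ ≤ θ / 10 * 1 := by gcongr
      _ = _ := by ring
  have hload : ∑ k, w k * (Z k - Y k) ≤ 4 * (θ / 10) := by
    have e : ∑ k, w k * (Z k - Y k) = ∑ k ∈ A, w k * (Z k - Y k) := by
      symm
      apply Finset.sum_subset (Finset.subset_univ _)
      intro k _ hk
      simp [Z, hk]
    rw [e]
    calc _ ≤ ∑ k ∈ A, 2 * (θ / 10) * min 1 (Y k) := by
          refine Finset.sum_le_sum fun k hk => ?_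
          have hkE := hAE hk
          have hqk := hq k hkE
          have hwk := hw k
          have hYk := hYpos k hkE
          have h1 : Real.exp (q k / 10) - 1 ≤ 2 * (q k / 10) := by
            have := Real.abs_exp_sub_one_le (x := q k / 10)
              (by rw [abs_of_pos (by positivity)]; linarith [hq1 k hkE])
            rw [abs_of_pos (a := q k / 10) (by positivity)] at this
            exact (le_abs_self _).trans this
          -- Raised candidates have level at most 1 and price below `θ`. At price exactly `θ` the
          -- level is unchanged and `max 1 x * min 1 x = x` gives equality; this is why prices
          -- contain `max 1 (X i)`.
          have h2 : w k * Y k * q k ≤ θ * min 1 (Y k) := by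
            rcases (hAθ k hk).lt_or_eq with hlt | heq
            · rw [min_eq_right (hY1 k hkE hlt)]
              have : w k * q k ≤ θ := by
                refine le_trans ?_ hlt.le
                have : w k * 1 * q k ≤ w k * max 1 (X k) * q k := by
                  gcongr; exact le_max_left _ _
                simpa using this
              calc w k * Y k * q k = w k * q k * Y k := by ring
                _ ≤ _ := by gcongr
            · have hYX := hYn k (fun hc => hc.2.ne heq)
              rw [← heq, hYX]
              have : max 1 (X k) * min 1 (X k) = X k := by rw [max_mul_min, one_mul]
              refine le_of_eq ?_
              simp only [h]
              linear_combination (-(w k * q k)) * this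
          simp only [Z, if_pos hk]
          calc w k * (Y k * Real.exp (q k / 10) - Y k)
              = w k * Y k * (Real.exp (q k / 10) - 1) := by ring
            _ ≤ w k * Y k * (2 * (q k / 10)) := by gcongr
            _ = 2 / 10 * (w k * Y k * q k) := by ring
            _ ≤ 2 / 10 * (θ * min 1 (Y k)) := by gcongr
            _ = _ := by ring
      _ = 2 * (θ / 10) * ∑ k ∈ A, min 1 (Y k) := by rw [Finset.mul_sum]
      _ ≤ 2 * (θ / 10) * 2 := by gcongr
      _ = _ := by ring
  have htot : ∑ k, w k * (Z k - X k) ≤ θ / 2 := by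
    have : ∑ k, w k * (Z k - X k) = ∑ k, w k * (Z k - Y k) + ∑ k, w k * (Y k - X k) := by
      rw [← Finset.sum_add_distrib]; exact Finset.sum_congr rfl fun k _ => by ring
    linarith
  refine ⟨Z, A, hAE, fun i => (hXY i).trans (hYZ i), fun i hi => ?_, ?_, fun i hi => ?_⟩
  · simp only [Z, if_pos hi]
    gcongr
    exact hXY i
  · exact hA1.trans (Finset.sum_le_sum fun i _ => hYZ i)
  · refine htot.trans ?_
    change θ / 2 ≤ 1 / 2 * h i + _
    have hXi := hX i hi
    have hwi := hw i
    rcases le_or_gt θ (h i) with hle' | hlt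
    · have : 0 ≤ w i * (min 0 (Real.log (Z i)) - min 0 (Real.log (X i))) := by
        refine mul_nonneg hwi.le (sub_nonneg.2 (min_le_min le_rfl ?_))
        exact Real.log_le_log hXi ((hXY i).trans (hYZ i))
      linarith
    -- Raised levels stay at most 1, so the cap at 0 hides none of the raise: the capped log gains
    -- at least `s i`, and `5 * w i * s i = (θ - h i) / 2`.
    · have hlogY : Real.log (Y i) = Real.log (X i) + s i := by
        rw [hYr i hi hlt, Real.log_mul hXi.ne' (Real.exp_ne_zero _), Real.log_exp]
      have hY0 : Real.log (Y i) ≤ 0 := Real.log_nonpos (hYpos i hi).le (hY1 i hi hlt)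
      have h1 : Real.log (Y i) ≤ min 0 (Real.log (Z i)) :=
        le_min hY0 (Real.log_le_log (hYpos i hi) (hYZ i))
      have h2 : min 0 (Real.log (X i)) ≤ Real.log (X i) := min_le_right _ _
      have h3 : w i * s i ≤ w i * (min 0 (Real.log (Z i)) - min 0 (Real.log (X i))) := by
        gcongr; linarith
      have h4 : w i * s i = (θ - h i) / 10 := by simp only [s]; field_simp
      linarith

/-! ### Telescoping over a run of steps. -/

lemma le_of_forall_le_succ {n : ℕ} {x : ℕ → ℝ} (h : ∀ k < n, x k ≤ x (k + 1)) {a b : ℕ}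
    (hab : a ≤ b) (hb : b ≤ n) : x a ≤ x b := by
  induction b, hab using Nat.le_induction with
  | base => exact le_rfl
  | succ b _ ih => exact (ih (by omega)).trans (h b (by omega))

lemma sum_fin_sub {n : ℕ} (f : ℕ → ℝ) : ∑ j : Fin n, (f (j + 1) - f j) = f n - f 0 := by
  rw [Fin.sum_univ_eq_sum_range (fun k => f (k + 1) - f k), Finset.sum_range_sub]

section Run

variable {ι : Type*} [Fintype ι] {n : ℕ} {w : ι → ℝ} {X : ℕ → ι → ℝ}
  {q : Fin n → ι → ℝ} {E A : Fin n → Finset ι}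

lemma level_mono (hstep : ∀ j : Fin n, IsStep w (q j) (X j) (E j) (X (j + 1)) (A j)) (i : ι)
    {a b : ℕ} (hab : a ≤ b) (hb : b ≤ n) : X a i ≤ X b i :=
  le_of_forall_le_succ (x := fun k => X k i) (fun k hk => (hstep ⟨k, hk⟩).le i) hab hb

lemma sum_load_le_log (hstep : ∀ j : Fin n, IsStep w (q j) (X j) (E j) (X (j + 1)) (A j)) (i : ι)
    (hX : 0 < X 0 i) [DecidablePred fun j => i ∈ A j] :
    ∑ j with i ∈ A j, q j i ≤ 10 * (Real.log (X n i) - Real.log (X 0 i)) := by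
  have hpos : ∀ k ≤ n, 0 < X k i := fun k hk => hX.trans_le (level_mono hstep i (Nat.zero_le k) hk)
  rw [← sum_fin_sub (n := n) (fun k => Real.log (X k i)), Finset.mul_sum, Finset.sum_filter]
  refine Finset.sum_le_sum fun j _ => ?_
  have h0 := hpos j j.2.le
  split_ifs with hj
  · have := Real.log_le_log (by positivity) ((hstep j).mul_exp_le i hj)
    rw [Real.log_mul h0.ne' (Real.exp_ne_zero _), Real.log_exp] at this
    linarith
  · have := Real.log_le_log h0 ((hstep j).le i)
    linarith

/-- Here `F` and `S` stand for the offline solution. Its prices contribute at most `1 + (∑ w i * X n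
i) / 2` and its capped logs at most `10 * log (1 / δ)`; absorbing the half into the left side
doubles everything else. -/
lemma potential_le (hstep : ∀ j : Fin n, IsStep w (q j) (X j) (E j) (X (j + 1)) (A j))
    [DecidableEq ι] (hw : ∀ i, 0 < w i) (F : Finset ι) (S : Fin n → ι)
    (hSF : ∀ j, S j ∈ F) (hSE : ∀ j, S j ∈ E j) (hq : ∀ j i, 0 ≤ q j i)
    (hload : ∀ i ∈ F, ∑ j with S j = i, q j i ≤ 1) (hwF : ∑ i ∈ F, w i ≤ 2) (hX0 : ∀ i, 0 ≤ X 0 i)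
    {δ : ℝ} (hδ : 0 < δ) (hδ1 : δ ≤ 1) (hXF : ∀ i ∈ F, δ ≤ X 0 i) :
    ∑ i, w i * X n i ≤ 2 * ∑ i, w i * X 0 i + 2 - 20 * Real.log δ := by
  have hXn : ∀ i, 0 ≤ X n i := fun i => (hX0 i).trans (level_mono hstep i (Nat.zero_le n) le_rfl)
  let Ψ : ℕ → ℝ := fun k => ∑ i ∈ F, w i * min 0 (Real.log (X k i))
  have hj : ∀ j : Fin n, ∑ k, w k * X (j + 1) k - ∑ k, w k * X j k ≤
      1 / 2 * (w (S j) * (1 + X n (S j)) * q j (S j)) + 5 * (Ψ (j + 1) - Ψ j) := by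
    intro j
    have h1 := (hstep j).sum_le _ (hSE j)
    have h2 : w (S j) * max 1 (X j (S j)) * q j (S j) ≤
        w (S j) * (1 + X n (S j)) * q j (S j) := by
      have := hw (S j)
      have := hq j (S j)
      have : max 1 (X j (S j)) ≤ 1 + X n (S j) :=
        max_le (by linarith [hXn (S j)]) (by
          linarith [level_mono hstep (S j) (a := j) j.2.le le_rfl])
      gcongr
    have h3 : w (S j) * (min 0 (Real.log (X (j + 1) (S j))) - min 0 (Real.log (X j (S j)))) ≤
        Ψ (j + 1) - Ψ j := by
      have : Ψ (j + 1) - Ψ j =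
          ∑ i ∈ F, w i * (min 0 (Real.log (X (j + 1) i)) - min 0 (Real.log (X j i))) := by
        rw [← Finset.sum_sub_distrib]; exact Finset.sum_congr rfl fun i _ => by ring
      rw [this]
      refine Finset.single_le_sum (f := fun i =>
        w i * (min 0 (Real.log (X (j + 1) i)) - min 0 (Real.log (X j i)))) (fun i hi => ?_) (hSF j)
      refine mul_nonneg (hw i).le (sub_nonneg.2 (min_le_min le_rfl ?_))
      refine Real.log_le_log ?_ ((hstep j).le i)
      exact (hδ.trans_le (hXF i hi)).trans_le (level_mono hstep i (Nat.zero_le _) j.2.le)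
    have h4 : ∑ k, w k * (X (j + 1) k - X j k) =
        ∑ k, w k * X (j + 1) k - ∑ k, w k * X j k := by
      rw [← Finset.sum_sub_distrib]; exact Finset.sum_congr rfl fun i _ => by ring
    linarith
  have hsum := Finset.sum_le_sum fun j (_ : j ∈ Finset.univ) => hj j
  rw [sum_fin_sub (fun k => ∑ i, w i * X k i), Finset.sum_add_distrib, ← Finset.mul_sum,
    ← Finset.mul_sum, sum_fin_sub] at hsum
  -- Grouping jobs by offline machine, each machine has normalised load at most 1.
  have hopt : ∑ j, w (S j) * (1 + X n (S j)) * q j (S j) ≤ 2 + ∑ i, w i * X n i := by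
    rw [← Finset.sum_fiberwise_of_maps_to (s := Finset.univ) (t := F) (g := S) fun j _ => hSF j]
    calc _ ≤ ∑ i ∈ F, (w i + w i * X n i) := by
          refine Finset.sum_le_sum fun i hi => ?_
          have : ∑ j with S j = i, w (S j) * (1 + X n (S j)) * q j (S j) =
              w i * (1 + X n i) * ∑ j with S j = i, q j i := by
            rw [Finset.mul_sum]
            refine Finset.sum_congr rfl fun j hj => ?_
            rw [(Finset.mem_filter.1 hj).2]
          rw [this]
          have h1 := mul_le_mul_of_nonneg_left (hload i hi)
            (mul_nonneg (hw i).le (by linarith [hXn i] : 0 ≤ 1 + X n i))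
          linarith
      _ = ∑ i ∈ F, w i + ∑ i ∈ F, w i * X n i := Finset.sum_add_distrib
      _ ≤ _ := add_le_add hwF (Finset.sum_le_sum_of_subset_of_nonneg (Finset.subset_univ _)
          fun i _ _ => mul_nonneg (hw i).le (hXn i))
  have hΨn : Ψ n ≤ 0 := Finset.sum_nonpos fun i _ =>
    mul_nonpos_of_nonneg_of_nonpos (hw i).le (min_le_left _ _)
  have hlogδ : Real.log δ ≤ 0 := Real.log_nonpos hδ.le hδ1
  have hΨ0 : 2 * Real.log δ ≤ Ψ 0 := by
    calc 2 * Real.log δ ≤ (∑ i ∈ F, w i) * Real.log δ :=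
          mul_le_mul_of_nonpos_right hwF hlogδ
      _ = ∑ i ∈ F, w i * Real.log δ := Finset.sum_mul _ _ _
      _ ≤ _ := Finset.sum_le_sum fun i hi => mul_le_mul_of_nonneg_left
          (le_min hlogδ (Real.log_le_log hδ (hXF i hi))) (hw i).le
  linarith

end Run

/-! ### Rounding by exponential thresholds. -/

section Rounding

open ProbabilityTheory

lemma expMeasure_Ioi {t : ℝ} (ht : 0 ≤ t) :
    (expMeasure 1) (Set.Ioi t) = ENNReal.ofReal (Real.exp (-t)) := by
  have := isProbabilityMeasure_expMeasure one_pos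
  have h := cdf_expMeasure_eq one_pos t
  rw [if_pos ht, cdf_eq_real, one_mul] at h
  have h2 := probReal_compl_eq_one_sub (μ := expMeasure 1) (measurableSet_Iic (a := t))
  rw [h, Set.compl_Iic] at h2
  rw [← ofReal_measureReal, h2]
  congr 1; ring

lemma expMeasure_Iic_le {t : ℝ} (ht : 0 ≤ t) : (expMeasure 1).real (Set.Iic t) ≤ t := by
  have := isProbabilityMeasure_expMeasure one_pos
  have h := cdf_expMeasure_eq one_pos t
  rw [if_pos ht, cdf_eq_real, one_mul] at h
  rw [h]
  linarith [Real.one_sub_le_exp_neg t]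

/-- The law of independent thresholds, each exponentially distributed with rate `1`. -/
noncomputable abbrev thresholdMeasure (ι : Type*) [Fintype ι] : Measure (ι → ℝ) :=
  Measure.pi fun _ => expMeasure 1

instance isProbabilityMeasure_thresholdMeasure (ι : Type*) [Fintype ι] :
    IsProbabilityMeasure (thresholdMeasure ι) := by
  have := isProbabilityMeasure_expMeasure one_pos
  infer_instance

/-- Exponential tails multiply to a function of the sum alone, so only the total candidate level
matters in the rounding. -/
lemma thresholdMeasure_forall_lt {ι : Type*} [Fintype ι] (A : Finset ι) (t : ι → ℝ)
    (ht : ∀ i ∈ A, 0 ≤ t i) :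
    (thresholdMeasure ι).real {τ | ∀ i ∈ A, t i < τ i} = Real.exp (-∑ i ∈ A, t i) := by
  have := isProbabilityMeasure_expMeasure one_pos
  have : {τ : ι → ℝ | ∀ i ∈ A, t i < τ i} = Set.pi A fun i => Set.Ioi (t i) := by
    ext; simp
  rw [measureReal_def, this, Measure.pi_pi_finset,
    Finset.prod_congr rfl fun i hi => expMeasure_Ioi (ht i hi),
    ← ENNReal.ofReal_prod_of_nonneg fun i _ => (Real.exp_pos _).le,
    ENNReal.toReal_ofReal (Finset.prod_nonneg fun i _ => (Real.exp_pos _).le),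
    ← Real.exp_sum, Finset.sum_neg_distrib]

lemma thresholdMeasure_le {ι : Type*} [Fintype ι] (i : ι) {t : ℝ} (ht : 0 ≤ t) :
    (thresholdMeasure ι).real {τ | τ i ≤ t} ≤ t := by
  have := isProbabilityMeasure_expMeasure one_pos
  have := (measurePreserving_eval (fun _ : ι => expMeasure 1) i).measureReal_preimage
    (measurableSet_Iic (a := t)).nullMeasurableSet
  exact this.le.trans (expMeasure_Iic_le ht)

/-- The set of thresholds for which some job has no open candidate. -/
def failure {ι : Type*} {n : ℕ} (A : Fin n → Finset ι) (t : Fin n → ι → ℝ) : Set (ι → ℝ) :=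
  ⋃ j, {τ | ∀ i ∈ A j, t j i < τ i}

lemma measurableSet_failure {ι : Type*} [Fintype ι] {n : ℕ} (A : Fin n → Finset ι)
    (t : Fin n → ι → ℝ) : MeasurableSet (failure A t) := by
  refine MeasurableSet.iUnion fun j => ?_
  have : {τ : ι → ℝ | ∀ i ∈ A j, t j i < τ i} = ⋂ i ∈ A j, {τ | t j i < τ i} := by ext; simp
  rw [this]
  exact Finset.measurableSet_biInter _ fun i _ =>
    measurableSet_lt measurable_const (measurable_pi_apply i)

lemma failure_le {ι : Type*} [Fintype ι] {n : ℕ} (A : Fin n → Finset ι) (t : Fin n → ι → ℝ)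
    {K : ℝ} (ht : ∀ j, ∀ i ∈ A j, 0 ≤ t j i) (hK : ∀ j, K ≤ ∑ i ∈ A j, t j i) :
    (thresholdMeasure ι).real (failure A t) ≤ n * Real.exp (-K) := by
  refine (measureReal_iUnion_fintype_le _).trans ?_
  calc _ ≤ ∑ _j : Fin n, Real.exp (-K) := Finset.sum_le_sum fun j _ => by
        rw [thresholdMeasure_forall_lt _ _ (ht j)]
        exact Real.exp_le_exp.2 (neg_le_neg (hK j))
    _ = _ := by simp

end Rounding

/-! ### The online algorithm and its deterministic guarantees. -/

section Algorithm

variable {m n : ℕ}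

/-- The machines that a budget-respecting schedule can use for a job with processing times `q`. -/
noncomputable def eligible (c : Fin m → ℝ) (L B : ℝ) (q : Fin m → ℝ) : Finset (Fin m) :=
  Finset.univ.filter fun i => c i ≤ B ∧ q i ≤ L

/-- The normalised startup cost of a machine. -/
noncomputable def weight (c : Fin m → ℝ) (B : ℝ) (i : Fin m) : ℝ := c i / B + 1 / m

/-- The activation levels before the first job. -/
noncomputable def initialLevel (c : Fin m → ℝ) (B : ℝ) (i : Fin m) : ℝ :=
  if c i ≤ B then 1 / m else 0

open Classical in
/-- The new activation levels and the candidate machines chosen when a job arrives. -/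
noncomputable def step (c : Fin m → ℝ) (L B : ℝ) (q X : Fin m → ℝ) :
    (Fin m → ℝ) × Finset (Fin m) :=
  if h : ∃ Y : (Fin m → ℝ) × Finset (Fin m),
    IsStep (weight c B) (fun i => q i / L) X (eligible c L B q) Y.1 Y.2 then h.choose else (X, ∅)

/-- The activation levels after the first `k` jobs. -/
noncomputable def level (c : Fin m → ℝ) (L B : ℝ) (p : Fin m → Fin n → ℝ) : ℕ → Fin m → ℝ
  | 0 => initialLevel c B
  | k + 1 => if h : k < n then (step c L B (fun i => p i ⟨k, h⟩) (level c L B p k)).1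
      else level c L B p k

/-- The candidate machines for job `j`. -/
noncomputable def candidates (c : Fin m → ℝ) (L B : ℝ) (p : Fin m → Fin n → ℝ) (j : Fin n) :
    Finset (Fin m) :=
  (step c L B (fun i => p i j) (level c L B p j)).2

open Classical in
/-- An element of `A` satisfying `b` if there is one, otherwise an element of `E` if there is
one. -/
noncomputable def pick {ι : Type*} [Nonempty ι] (A E : Finset ι) (b : ι → Prop) : ι :=
  if h : ∃ i ∈ A, b i then h.choose
  else if h : E.Nonempty then h.choose else Classical.arbitrary ι

lemma pick_spec {ι : Type*} [Nonempty ι] {A : Finset ι} (E : Finset ι) {b : ι → Prop}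
    (h : ∃ i ∈ A, b i) : b (pick A E b) ∧ pick A E b ∈ A := by
  rw [pick, dif_pos h]
  exact ⟨h.choose_spec.2, h.choose_spec.1⟩

/-- The fallback keeps jobs on eligible machines even when rounding fails, which caps the cost by `m
* B` on every outcome. -/
lemma pick_mem {ι : Type*} [Nonempty ι] {A E : Finset ι} (b : ι → Prop) (hAE : A ⊆ E)
    (hE : E.Nonempty) : pick A E b ∈ E := by
  by_cases h : ∃ i ∈ A, b i
  · exact hAE (pick_spec E h).2
  · rw [pick, dif_neg h, dif_pos hE]
    exact hE.choose_spec

lemma level_congr (c : Fin m → ℝ) (L B : ℝ) {p p' : Fin m → Fin n → ℝ} (k : ℕ)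
    (h : ∀ l : Fin n, (l : ℕ) < k → ∀ i, p i l = p' i l) :
    level c L B p k = level c L B p' k := by
  induction k with
  | zero => rfl
  | succ k ih =>
    simp only [level]
    rw [ih fun l hl => h l (by omega)]
    split_ifs with hk
    · have : (fun i => p i ⟨k, hk⟩) = fun i => p' i ⟨k, hk⟩ :=
        funext fun i => h ⟨k, hk⟩ (Nat.lt_succ_self k) i
      rw [this]
    · rfl

/-- The algorithm with rounding parameter `K`: a machine is open once its activation level times `K`
exceeds its random threshold, and a job goes to an open candidate machine if there is one. -/
noncomputable def algorithm [NeZero m] (c : Fin m → ℝ) (L B K : ℝ) :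
    RandomizedOnlineAlgorithm m n where
  Ω := Fin m → ℝ
  μ := thresholdMeasure (Fin m)
  assign τ p j := pick (candidates c L B p j) (eligible c L B fun i => p i j)
    -- The level after the update for job `j` is used, since only then do the candidate levels sum
    -- to at least 1.
    fun i => τ i ≤ K * level c L B p (j + 1) i
  nonanticipating τ p p' j h := by
    have h1 : level c L B p j = level c L B p' j :=
      level_congr c L B j fun l hl => h l (Fin.le_def.2 hl.le)
    have h2 : level c L B p (j + 1) = level c L B p' (j + 1) :=
      level_congr c L B (j + 1) fun l hl => h l (Fin.le_def.2 (Nat.lt_succ_iff.1 hl))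
    have h3 : (fun i => p i j) = fun i => p' i j := funext (h j le_rfl)
    simp only [candidates, h1, h2, h3]
  measurable_assign p j := by
    have h1 : Measurable fun (τ : Fin m → ℝ) i => τ i ≤ K * level c L B p (j + 1) i :=
      measurable_pi_iff.2 fun i => measurable_to_prop
        (by simpa [Set.preimage] using measurableSet_le (measurable_pi_apply i) measurable_const)
    -- The choice depends on the thresholds only through the open/closed pattern, which takes
    -- finitely many values.
    exact (Measurable.of_discrete (f := fun b : Fin m → Prop =>
      pick (candidates c L B p j) (eligible c L B fun i => p i j) b)).comp h1

lemma load_le_makespan (p : Fin m → Fin n → ℝ) (S : Schedule m n) (i : Fin m) :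
    load p S i ≤ makespan p S :=
  le_ciSup (Set.finite_range _).bddAbove i

lemma load_nonneg {p : Fin m → Fin n → ℝ} (hp : ∀ i j, 0 < p i j) (S : Schedule m n)
    (i : Fin m) : 0 ≤ load p S i :=
  Finset.sum_nonneg fun j _ => (hp i j).le

lemma mem_activeMachines (S : Schedule m n) (j : Fin n) : S j ∈ activeMachines S := by
  simp [activeMachines]

section Feasible

variable {c : Fin m → ℝ} {L B : ℝ} {p : Fin m → Fin n → ℝ} {S : Schedule m n}

lemma apply_le_of_makespan_le (hp : ∀ i j, 0 < p i j) (hS : makespan p S ≤ L) (j : Fin n) :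
    p (S j) j ≤ L :=
  (Finset.single_le_sum (f := fun j' => p (S j) j') (fun k _ => (hp _ k).le)
    (by simp : j ∈ Finset.univ.filter fun k => S k = S j)).trans
    ((load_le_makespan p S (S j)).trans hS)

lemma le_of_mem_activeMachines (hc : ∀ i, 0 ≤ c i) (hS : startupCost c S ≤ B) {i : Fin m}
    (hi : i ∈ activeMachines S) : c i ≤ B :=
  (Finset.single_le_sum (f := c) (fun k _ => hc k) hi).trans hS

lemma mem_eligible_of_feasible (hc : ∀ i, 0 ≤ c i) (hp : ∀ i j, 0 < p i j)
    (hSL : makespan p S ≤ L) (hSB : startupCost c S ≤ B) (j : Fin n) :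
    S j ∈ eligible c L B fun i => p i j :=
  Finset.mem_filter.2 ⟨Finset.mem_univ _,
    le_of_mem_activeMachines hc hSB (mem_activeMachines S j), apply_le_of_makespan_le hp hSL j⟩

lemma weight_pos [NeZero m] (hc : ∀ i, 0 ≤ c i) (hB : 0 ≤ B) (i : Fin m) : 0 < weight c B i := by
  have : (0 : ℝ) < m := by exact_mod_cast Nat.pos_of_ne_zero (NeZero.ne m)
  have := hc i
  unfold weight
  positivity

/-- For `B = 0` the quotient `c i / B` is 0 by convention, but then `c i ≤ 0` as well. -/
lemma le_mul_weight (hB : 0 ≤ B) {i : Fin m} (hi : c i ≤ B) :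
    c i ≤ B * weight c B i := by
  have h : c i ≤ B * (c i / B) := by
    rcases hB.eq_or_lt with rfl | hB
    · simpa using hi
    · rw [mul_div_cancel₀ _ hB.ne']
  have : 0 ≤ B * (1 / m) := by positivity
  rw [weight, mul_add]
  linarith

lemma sum_weight_le (hB : 0 ≤ B) (F : Finset (Fin m)) (hF : ∑ i ∈ F, c i ≤ B) :
    ∑ i ∈ F, weight c B i ≤ 2 := by
  simp only [weight]
  rw [Finset.sum_add_distrib, ← Finset.sum_div, Finset.sum_const, nsmul_eq_mul]
  have h1 : (∑ i ∈ F, c i) / B ≤ 1 := div_le_one_of_le₀ hF hB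
  have h2 : (F.card : ℝ) * (1 / m) ≤ 1 := by
    rw [mul_one_div]
    refine div_le_one_of_le₀ ?_ (Nat.cast_nonneg _)
    exact_mod_cast (Finset.card_le_univ F).trans_eq (Fintype.card_fin m)
  linarith

lemma sum_weight_mul_initialLevel_le (hB : 0 ≤ B) :
    ∑ i, weight c B i * initialLevel c B i ≤ 2 := by
  have hm : (m : ℝ) * (1 / m) ≤ 1 := by
    rw [mul_one_div]; exact div_self_le_one _
  calc _ ≤ ∑ _i : Fin m, 2 * (1 / m : ℝ) := by
        refine Finset.sum_le_sum fun i _ => ?_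
        unfold initialLevel
        split_ifs with h
        · have h1 : c i / B ≤ 1 := div_le_one_of_le₀ h hB
          have h2 : (1 / m : ℝ) ≤ 1 := by
            rcases Nat.eq_zero_or_pos m with h0 | h0
            · exact absurd i.2 (by omega)
            · rw [div_le_one (by exact_mod_cast h0)]; exact_mod_cast h0
          have : weight c B i ≤ 2 := by unfold weight; linarith
          gcongr
        · rw [mul_zero]; positivity
    _ = 2 * (m * (1 / m)) := by simp; ring
    _ ≤ 2 := by linarith

lemma initialLevel_nonneg (i : Fin m) : 0 ≤ initialLevel c B i := by
  unfold initialLevel; split_ifs <;> positivity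

lemma isStep_level [NeZero m] (hc : ∀ i, 0 ≤ c i) (hp : ∀ i j, 0 < p i j)
    (hSL : makespan p S ≤ L) (hSB : startupCost c S ≤ B) (hB : 0 ≤ B) (j : Fin n) :
    IsStep (weight c B) (fun i => p i j / L) (level c L B p j) (eligible c L B fun i => p i j)
      (level c L B p (j + 1)) (candidates c L B p j) := by
  have hm : (0 : ℝ) < m := by exact_mod_cast Nat.pos_of_ne_zero (NeZero.ne m)
  have hL : 0 < L := (hp _ j).trans_le (apply_le_of_makespan_le hp hSL j)
  -- A step exists only from positive levels, and positivity persists only through steps, so the two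
  -- are proved by a joint induction.
  have key : ∀ j : Fin n, (∀ i, c i ≤ B → 0 < level c L B p j i) →
      IsStep (weight c B) (fun i => p i j / L) (level c L B p j) (eligible c L B fun i => p i j)
        (level c L B p (j + 1)) (candidates c L B p j) := by
    intro j hpos
    obtain ⟨Z, A, h⟩ := exists_isStep (weight c B) (fun i => p i j / L) (level c L B p j)
      (eligible c L B fun i => p i j) ⟨S j, mem_eligible_of_feasible hc hp hSL hSB j⟩
      (weight_pos hc hB) (fun i _ => div_pos (hp i j) hL)
      (fun i hi => (div_le_one hL).2 (Finset.mem_filter.1 hi).2.2)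
      (fun i hi => hpos i (Finset.mem_filter.1 hi).2.1)
    have hex : ∃ Y : (Fin m → ℝ) × Finset (Fin m), IsStep (weight c B) (fun i => p i j / L)
      (level c L B p j) (eligible c L B fun i => p i j) Y.1 Y.2 := ⟨(Z, A), h⟩
    have e : level c L B p (j + 1) = (step c L B (fun i => p i j) (level c L B p j)).1 := by
      simp [level]
    rw [e, candidates, step, dif_pos hex]
    exact hex.choose_spec
  have hpos : ∀ k ≤ n, ∀ i, c i ≤ B → 0 < level c L B p k i := by
    intro k
    induction k with
    | zero =>
      intro _ i hi
      simp only [level, initialLevel, if_pos hi]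
      positivity
    | succ k ih =>
      intro hk i hi
      have hpk := ih (by omega)
      exact (hpk i hi).trans_le ((key ⟨k, hk⟩ hpk).le i)
  exact key j (hpos j j.2.le)

lemma potential_level_le [NeZero m] (hc : ∀ i, 0 ≤ c i) (hp : ∀ i j, 0 < p i j)
    (hSL : makespan p S ≤ L) (hSB : startupCost c S ≤ B) (hB : 0 ≤ B) :
    ∑ i, weight c B i * level c L B p n i ≤ 6 + 20 * Real.log m := by
  have hm : 1 ≤ m := Nat.pos_of_ne_zero (NeZero.ne m)
  have hm' : (1 : ℝ) ≤ m := by exact_mod_cast hm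
  have hδ : (0 : ℝ) < 1 / m := by positivity
  have hL0 : 0 ≤ L := (load_nonneg hp S ⟨0, hm⟩).trans ((load_le_makespan p S _).trans hSL)
  have h := potential_le (δ := 1 / m) (fun j => isStep_level hc hp hSL hSB hB j) (weight_pos hc hB)
    (activeMachines S) S (mem_activeMachines S) (mem_eligible_of_feasible hc hp hSL hSB)
    (fun j i => div_nonneg (hp i j).le hL0)
    (fun i _ => by
      rw [← Finset.sum_div]
      exact div_le_one_of_le₀ ((load_le_makespan p S i).trans hSL) hL0)
    (sum_weight_le hB _ hSB) initialLevel_nonneg hδ (by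
      rw [div_le_one (by linarith)]; exact hm')
    (fun i hi => by
      simp only [level, initialLevel, if_pos (le_of_mem_activeMachines hc hSB hi)]; exact le_rfl)
  have h0 : ∑ i, weight c B i * level c L B p 0 i ≤ 2 := sum_weight_mul_initialLevel_le hB
  rw [one_div, Real.log_inv] at h
  linarith

lemma sum_candidates_le [NeZero m] (hm2 : 2 ≤ m) (hc : ∀ i, 0 ≤ c i) (hp : ∀ i j, 0 < p i j)
    (hSL : makespan p S ≤ L) (hSB : startupCost c S ≤ B) (hB : 0 ≤ B) {i : Fin m} (hi : c i ≤ B) :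
    ∑ j with i ∈ candidates c L B p j, p i j ≤ 80 * L * Real.log m := by
  have hm' : (2 : ℝ) ≤ m := by exact_mod_cast hm2
  rcases Nat.eq_zero_or_pos n with rfl | hn
  · have hL0 : 0 ≤ L := (load_nonneg hp S i).trans ((load_le_makespan p S _).trans hSL)
    have := Real.log_nonneg (by linarith : (1 : ℝ) ≤ m)
    simp only [Finset.univ_eq_empty, Finset.filter_empty, Finset.sum_empty]
    positivity
  have hL : 0 < L := (hp _ ⟨0, hn⟩).trans_le (apply_le_of_makespan_le hp hSL ⟨0, hn⟩)
  have hX0 : level c L B p 0 i = 1 / m := by simp [level, initialLevel, hi]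
  have h := sum_load_le_log (fun j => isStep_level hc hp hSL hSB hB j) i
    (by rw [hX0]; positivity)
  rw [hX0, one_div, Real.log_inv, ← Finset.sum_div] at h
  have hXpos : ∀ i, 0 ≤ level c L B p n i := fun i => (initialLevel_nonneg i).trans
    (level_mono (fun j => isStep_level hc hp hSL hSB hB j) i (Nat.zero_le n) le_rfl)
  have hXi : 0 < level c L B p n i := by
    have := level_mono (fun j => isStep_level hc hp hSL hSB hB j) i (Nat.zero_le n) le_rfl
    rw [hX0] at this
    exact lt_of_lt_of_le (by positivity) this
  -- The summand `1 / m` in the weight serves here: it bounds the level even of a machine with zero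
  -- startup cost.
  have hΦ : 1 / m * level c L B p n i ≤ 6 + 20 * Real.log m := by
    refine le_trans ?_ (potential_level_le hc hp hSL hSB hB)
    refine le_trans ?_ (Finset.single_le_sum (f := fun i => weight c B i * level c L B p n i)
      (fun k _ => mul_nonneg (weight_pos hc hB k).le (hXpos k)) (Finset.mem_univ i))
    have : 1 / (m : ℝ) ≤ weight c B i := by
      have : 0 ≤ c i / B := div_nonneg (hc i) hB
      unfold weight; linarith
    have := hXpos i
    gcongr
  have hlog : Real.log m ≤ m - 1 := Real.log_le_sub_one_of_pos (by linarith)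
  -- The growth is from `1 / m` to at most `m ^ 7`, so the log-level gains at most `8 * log m`,
  -- whence 80.
  have hXle : level c L B p n i ≤ (m : ℝ) ^ 7 := by
    rw [one_div, inv_mul_le_iff₀ (by linarith)] at hΦ
    have h5 : (2 : ℝ) ^ 5 ≤ (m : ℝ) ^ 5 := by gcongr
    calc level c L B p n i ≤ m * (6 + 20 * Real.log m) := hΦ
      _ ≤ m * (32 * m) := by gcongr; linarith
      _ = m ^ 2 * 2 ^ 5 := by ring
      _ ≤ m ^ 2 * m ^ 5 := by gcongr
      _ = m ^ 7 := by ring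
  have := Real.log_le_log hXi hXle
  rw [Real.log_pow] at this
  push_cast at this
  have h2 : (∑ j with i ∈ candidates c L B p j, p i j) / L ≤ 80 * Real.log m := by linarith
  rw [div_le_iff₀ hL] at h2
  linarith

end Feasible

end Algorithm

/-! ### Makespan and expected cost of the rounded schedule. -/

section Analysis

variable {m n : ℕ} [NeZero m] {c : Fin m → ℝ} {L B : ℝ} {p : Fin m → Fin n → ℝ} {S : Schedule m n}

/-- The set of thresholds for which some job has no open candidate machine. -/
def failureSet (c : Fin m → ℝ) (L B : ℝ) (p : Fin m → Fin n → ℝ) (K : ℝ) : Set (Fin m → ℝ) :=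
  failure (candidates c L B p) fun j i => K * level c L B p (j + 1) i

lemma level_nonneg (hc : ∀ i, 0 ≤ c i) (hp : ∀ i j, 0 < p i j)
    (hSL : makespan p S ≤ L) (hSB : startupCost c S ≤ B) (hB : 0 ≤ B) {k : ℕ} (hk : k ≤ n)
    (i : Fin m) : 0 ≤ level c L B p k i :=
  (initialLevel_nonneg i).trans
    (level_mono (fun j => isStep_level hc hp hSL hSB hB j) i (Nat.zero_le k) hk)

lemma failureSet_le (hc : ∀ i, 0 ≤ c i) (hp : ∀ i j, 0 < p i j)
    (hSL : makespan p S ≤ L) (hSB : startupCost c S ≤ B) (hB : 0 ≤ B) {K : ℝ} (hK : 0 ≤ K) :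
    (thresholdMeasure (Fin m)).real (failureSet c L B p K) ≤ n * Real.exp (-K) := by
  refine failure_le _ _
    (fun j i _ => mul_nonneg hK (level_nonneg hc hp hSL hSB hB j.2 i)) fun j => ?_
  rw [← Finset.mul_sum]
  exact le_mul_of_one_le_right hK (isStep_level hc hp hSL hSB hB j).one_le_sum

lemma assign_of_notMem_failureSet {K : ℝ} {τ : Fin m → ℝ} (hτ : τ ∉ failureSet c L B p K)
    (j : Fin n) :
    τ ((algorithm c L B K).assign τ p j) ≤
        K * level c L B p (j + 1) ((algorithm c L B K).assign τ p j) ∧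
      (algorithm c L B K).assign τ p j ∈ candidates c L B p j := by
  refine pick_spec (b := fun i => τ i ≤ K * level c L B p (j + 1) i) _ ?_
  by_contra! h
  exact hτ (Set.mem_iUnion.2 ⟨j, h⟩)

lemma assign_mem_eligible (hc : ∀ i, 0 ≤ c i) (hp : ∀ i j, 0 < p i j)
    (hSL : makespan p S ≤ L) (hSB : startupCost c S ≤ B) (hB : 0 ≤ B) (K : ℝ) (τ : Fin m → ℝ)
    (j : Fin n) : (algorithm c L B K).assign τ p j ∈ eligible c L B fun i => p i j :=
  pick_mem _ (isStep_level hc hp hSL hSB hB j).subset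
    ⟨S j, mem_eligible_of_feasible hc hp hSL hSB j⟩

/-- Outside failure every job goes to a candidate, so the load is at most the candidate load,
whatever the thresholds are. -/
lemma makespan_algorithm_le (hm2 : 2 ≤ m) (hc : ∀ i, 0 ≤ c i) (hp : ∀ i j, 0 < p i j)
    (hSL : makespan p S ≤ L) (hSB : startupCost c S ≤ B) (hB : 0 ≤ B) {K : ℝ}
    {τ : Fin m → ℝ} (hτ : τ ∉ failureSet c L B p K) :
    makespan p ((algorithm c L B K).assign τ p) ≤ 80 * L * Real.log m := by
  refine ciSup_le fun i => ?_
  by_cases hi : c i ≤ B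
  · refine le_trans ?_ (sum_candidates_le hm2 hc hp hSL hSB hB hi)
    refine Finset.sum_le_sum_of_subset_of_nonneg (fun j hj => ?_) fun j _ _ => (hp i j).le
    simp only [Finset.mem_filter, Finset.mem_univ, true_and] at hj ⊢
    exact hj ▸ (assign_of_notMem_failureSet hτ j).2
  · have hL0 : 0 ≤ L := (load_nonneg hp S i).trans ((load_le_makespan p S _).trans hSL)
    have hlog : 0 ≤ Real.log m := Real.log_natCast_nonneg m
    rw [load, Finset.filter_false_of_mem, Finset.sum_empty]
    · positivity
    · rintro j - rfl
      exact hi (Finset.mem_filter.1 (assign_mem_eligible hc hp hSL hSB hB K τ j)).2.1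

/-- Levels never decrease, so without failure a used machine is still open at the final level. -/
lemma startupCost_algorithm_le (hc : ∀ i, 0 ≤ c i) (hp : ∀ i j, 0 < p i j)
    (hSL : makespan p S ≤ L) (hSB : startupCost c S ≤ B) (hB : 0 ≤ B) {K : ℝ} (hK : 0 ≤ K)
    (τ : Fin m → ℝ) :
    startupCost c ((algorithm c L B K).assign τ p) ≤
      ∑ i with c i ≤ B, c i * {τ : Fin m → ℝ | τ i ≤ K * level c L B p n i}.indicator 1 τ +
        m * B * (failureSet c L B p K).indicator 1 τ := by
  set T := (algorithm c L B K).assign τ p with hT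
  have hactive : ∀ i ∈ activeMachines T, c i ≤ B := by
    intro i hi
    obtain ⟨j, rfl⟩ := (Finset.mem_filter.1 hi).2
    exact (Finset.mem_filter.1 (assign_mem_eligible hc hp hSL hSB hB K τ j)).2.1
  have hterm : ∀ i,
      0 ≤ c i * {τ : Fin m → ℝ | τ i ≤ K * level c L B p n i}.indicator (1 : (Fin m → ℝ) → ℝ) τ :=
    fun i => mul_nonneg (hc i) (Set.indicator_nonneg (fun _ _ => zero_le_one) _)
  by_cases hτ : τ ∈ failureSet c L B p K
  · have h1 : startupCost c T ≤ m * B := by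
      calc startupCost c T ≤ ∑ i ∈ activeMachines T, B := Finset.sum_le_sum hactive
        _ = (activeMachines T).card * B := by simp
        _ ≤ m * B := by
          gcongr
          exact (Finset.card_le_univ _).trans_eq (Fintype.card_fin m)
    rw [Set.indicator_of_mem hτ, Pi.one_apply, mul_one]
    have := Finset.sum_nonneg fun i (_ : i ∈ Finset.univ.filter fun i => c i ≤ B) => hterm i
    linarith
  · rw [Set.indicator_of_notMem hτ, mul_zero, add_zero]
    calc startupCost c T = ∑ i ∈ activeMachines T,
          c i * {τ : Fin m → ℝ | τ i ≤ K * level c L B p n i}.indicator (1 : (Fin m → ℝ) → ℝ) τ := by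
          refine Finset.sum_congr rfl fun i hi => ?_
          obtain ⟨j, rfl⟩ := (Finset.mem_filter.1 hi).2
          rw [Set.indicator_of_mem, Pi.one_apply, mul_one]
          refine (assign_of_notMem_failureSet hτ j).1.trans ?_
          exact mul_le_mul_of_nonneg_left
            (level_mono (fun j => isStep_level hc hp hSL hSB hB j) _ j.2 le_rfl) hK
      _ ≤ _ := Finset.sum_le_sum_of_subset_of_nonneg
          (fun i hi => Finset.mem_filter.2 ⟨Finset.mem_univ i, hactive i hi⟩) fun i _ _ => hterm i

lemma expectedCost_algorithm_le (hc : ∀ i, 0 ≤ c i) (hp : ∀ i j, 0 < p i j)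
    (hSL : makespan p S ≤ L) (hSB : startupCost c S ≤ B) (hB : 0 ≤ B) {K : ℝ} (hK : 0 ≤ K) :
    (algorithm c L B K).expectedCost c p ≤
      K * B * (6 + 20 * Real.log m) + m * B * (n * Real.exp (-K)) := by
  have hmeas : ∀ i, MeasurableSet {τ : Fin m → ℝ | τ i ≤ K * level c L B p n i} := fun i =>
    measurableSet_le (measurable_pi_apply i) measurable_const
  have hmf : MeasurableSet (failureSet c L B p K) := measurableSet_failure _ _
  have hint : ∀ s : Set (Fin m → ℝ), MeasurableSet s →
      Integrable (s.indicator (1 : (Fin m → ℝ) → ℝ)) (thresholdMeasure (Fin m)) := fun s hs =>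
    (integrable_const (1 : ℝ)).indicator hs
  have hi1 : Integrable (fun τ => ∑ i with c i ≤ B,
      c i * {τ : Fin m → ℝ | τ i ≤ K * level c L B p n i}.indicator (1 : (Fin m → ℝ) → ℝ) τ)
      (thresholdMeasure (Fin m)) :=
    integrable_finsetSum _ fun i _ => (hint _ (hmeas i)).const_mul _
  have hi2 : Integrable (fun τ => m * B * (failureSet c L B p K).indicator (1 : (Fin m → ℝ) → ℝ) τ)
      (thresholdMeasure (Fin m)) := (hint _ hmf).const_mul _
  have hle := integral_mono_of_nonneg (μ := thresholdMeasure (Fin m))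
    (Filter.Eventually.of_forall fun τ => Finset.sum_nonneg fun i _ => hc i)
    (hi1.add hi2)
    (Filter.Eventually.of_forall (startupCost_algorithm_le hc hp hSL hSB hB hK))
  refine hle.trans ?_
  simp only [Pi.add_apply]
  rw [integral_add hi1 hi2, integral_finsetSum _ fun i _ => (hint _ (hmeas i)).const_mul _,
    integral_const_mul, integral_indicator_one hmf]
  have hl := fun i => level_nonneg hc hp hSL hSB hB le_rfl i
  gcongr
  · calc _ ≤ ∑ i with c i ≤ B, K * B * (weight c B i * level c L B p n i) := by
          refine Finset.sum_le_sum fun i hi => ?_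
          rw [integral_const_mul, integral_indicator_one (hmeas i)]
          have h1 := le_mul_weight hB (Finset.mem_filter.1 hi).2
          have h2 := thresholdMeasure_le i (mul_nonneg hK (hl i))
          calc _ ≤ c i * (K * level c L B p n i) := mul_le_mul_of_nonneg_left h2 (hc i)
            _ ≤ B * weight c B i * (K * level c L B p n i) :=
                mul_le_mul_of_nonneg_right h1 (mul_nonneg hK (hl i))
            _ = _ := by ring
      _ ≤ ∑ i, K * B * (weight c B i * level c L B p n i) :=
          Finset.sum_le_sum_of_subset_of_nonneg (Finset.subset_univ _) fun i _ _ =>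
            mul_nonneg (mul_nonneg hK hB) (mul_nonneg (weight_pos hc hB i).le (hl i))
      _ = K * B * ∑ i, weight c B i * level c L B p n i := by rw [Finset.mul_sum]
      _ ≤ _ := mul_le_mul_of_nonneg_left (potential_level_le hc hp hSL hSB hB) (mul_nonneg hK hB)
  · exact failureSet_le hc hp hSL hSB hB hK

lemma le_probMakespanLE_algorithm (hm2 : 2 ≤ m) (hc : ∀ i, 0 ≤ c i) (hp : ∀ i j, 0 < p i j)
    (hSL : makespan p S ≤ L) (hSB : startupCost c S ≤ B) (hB : 0 ≤ B) {K : ℝ} (hK : 0 ≤ K)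
    {t : ℝ} (ht : 80 * L * Real.log m ≤ t) :
    1 - n * Real.exp (-K) ≤ (algorithm c L B K).probMakespanLE p t := by
  have h1 := probReal_compl_eq_one_sub (μ := thresholdMeasure (Fin m))
    (measurableSet_failure (candidates c L B p) fun j i => K * level c L B p (j + 1) i)
  have h2 := failureSet_le hc hp hSL hSB hB hK
  calc 1 - n * Real.exp (-K)
      ≤ (thresholdMeasure (Fin m)).real (failureSet c L B p K)ᶜ := by
        rw [failureSet] at h2 ⊢; linarith
    _ ≤ _ := measureReal_mono (μ := thresholdMeasure (Fin m)) fun τ hτ =>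
        (makespan_algorithm_le hm2 hc hp hSL hSB hB hτ).trans ht

end Analysis

end MachineActivation

/-! ### Choice of `K` and of the constant. -/

theorem theorem1 :
    ∃ C : ℝ, 0 < C ∧
      ∀ (m n : ℕ), 2 ≤ m →
      ∀ c : Fin m → ℝ, (∀ i, 0 ≤ c i) →
      ∀ L B : ℝ,
      ∃ A : MachineActivation.RandomizedOnlineAlgorithm m n,
        ∀ p : Fin m → Fin n → ℝ, (∀ i j, 0 < p i j) →
        (∃ S : MachineActivation.Schedule m n,
          MachineActivation.makespan p S ≤ L ∧ MachineActivation.startupCost c S ≤ B) →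
        A.expectedCost c p ≤ C * B * Real.log ((m : ℝ) * (n : ℝ)) * Real.log (m : ℝ) ∧
        1 - 2 / (m : ℝ) ≤ A.probMakespanLE p (C * L * Real.log (m : ℝ)) := by
  refine ⟨100, by norm_num, fun m n hm c hc L B => ?_⟩
  have : NeZero m := ⟨by omega⟩
  have hm' : (2 : ℝ) ≤ m := by exact_mod_cast hm
  have hlm : (0.69 : ℝ) ≤ Real.log m :=
    (by linarith [Real.log_two_gt_d9] : (0.69 : ℝ) ≤ Real.log 2).trans
      (Real.log_le_log two_pos hm')
  set K := 2 * Real.log ((m : ℝ) * n) with hKdef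
  refine ⟨MachineActivation.algorithm c L B K, ?_⟩
  rintro p hp ⟨S, hSL, hSB⟩
  have hB : 0 ≤ B := (Finset.sum_nonneg fun i _ => hc i).trans hSB
  have hL : 0 ≤ L := (MachineActivation.load_nonneg hp S ⟨0, by omega⟩).trans
    ((MachineActivation.load_le_makespan p S _).trans hSL)
  have hK : 0 ≤ K := by
    have := Real.log_natCast_nonneg (m * n)
    push_cast at this
    linarith
  -- For `n ≥ 1`, `exp (-K) = (mn)⁻²`, so the left side is `1 / (mn)`.
  have hfail : m * (n * Real.exp (-K)) ≤ 1 := by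
    rcases Nat.eq_zero_or_pos n with rfl | hn
    · simp
    · have hn' : (1 : ℝ) ≤ n := by exact_mod_cast hn
      have hmn : 1 ≤ (m : ℝ) * n := by nlinarith
      have : Real.exp (-K) = (((m : ℝ) * n) ^ 2)⁻¹ := by
        rw [Real.exp_neg, hKdef, two_mul, Real.exp_add, Real.exp_log (by linarith), sq]
      rw [this, ← mul_assoc, ← div_eq_mul_inv, sq, div_self_mul_self']
      exact inv_le_one_of_one_le₀ hmn
  have hprob : n * Real.exp (-K) ≤ 1 / m := by
    rw [le_div_iff₀ (by linarith)]; linarith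
  constructor
  · refine (MachineActivation.expectedCost_algorithm_le hc hp hSL hSB hB hK).trans ?_
    rcases Nat.eq_zero_or_pos n with rfl | hn
    -- For `n = 0`, `Real.log 0 = 0` makes both `K` and the bound vanish.
    · simp [hKdef]
    · have hn' : (1 : ℝ) ≤ n := by exact_mod_cast hn
      have hlmn : Real.log m ≤ Real.log ((m : ℝ) * n) :=
        Real.log_le_log (by linarith) (le_mul_of_one_le_right (by linarith) hn')
      set l := Real.log (m : ℝ)
      set k := Real.log ((m : ℝ) * n)
      have h1 : m * B * (n * Real.exp (-K)) ≤ B := by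
        calc _ = B * (m * (n * Real.exp (-K))) := by ring
          _ ≤ B * 1 := by gcongr
          _ = B := mul_one B
      have h2 : 0.69 * 0.69 ≤ k * l := by
        have : (0.69 : ℝ) ≤ k := hlm.trans hlmn
        gcongr
      have h3 : k * (6 + 20 * l) ≤ k * (30 * l) :=
        mul_le_mul_of_nonneg_left (by linarith) (by linarith)
      have h4 : 2 * (k * (6 + 20 * l)) + 1 ≤ 100 * (k * l) := by linarith
      have h5 := mul_le_mul_of_nonneg_left h4 hB
      calc _ ≤ K * B * (6 + 20 * l) + B := by linarith
        _ = B * (2 * (k * (6 + 20 * l)) + 1) := by rw [hKdef]; ring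
        _ ≤ _ := h5
        _ = _ := by ring
  · refine le_trans ?_ (MachineActivation.le_probMakespanLE_algorithm hm hc hp hSL hSB hB hK ?_)
    · have : (1 : ℝ) / m ≤ 2 / m := by gcongr; norm_num
      linarith
    · have : 0 ≤ L * Real.log m := mul_nonneg hL (by linarith)
      linarith
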